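/- Let $q>2$ be a prime power, let $V$ be a $3$-dimensional vector space over the field $K=\mathbf F_q$, and let $X$ be a plane of the affine space $\mathbf A={\rm AG}(V)={\rm AG}(3,q)$. For a permutation $\pi$ of the points of $X$, let $\mathbf D_\pi$ be the geometry whose points are the points of $\mathbf A$ and whose blocks are the lines of $\mathbf A$ not contained in $X$ together with the sets $L^\pi$ for the lines $L\subset X$. Let ${\rm A\Gamma L}(X)$ be the group of invertible affine semilinear transformations of the affine plane $X$, viewed as a subgroup of ${\rm Sym}(X)$, and let ${\rm A\Gamma L}(2,q)$ be the group of invertible affine semilinear transformations of $K^2$. Permutations act on the right, and $H^\pi=\pi^{-1}H\pi$. (1) For all $\pi,\pi'\in{\rm Sym}(X)$, the geometries $\mathbf D_\pi$ and $\mathbf D_{\pi'}$ are isomorphic by an isomorphism sending $X$ to itself if and only if $\pi$ and $\pi'$ are in the same ${\rm A\Gamma L}(X),{\rm A\Gamma L}(X)$ double coset in ${\rm Sym}(X)$. (2) Among the $\mathbf D_\pi$, $\pi\in{\rm Sym}(X)$, there are at least $$\frac{(q^2)!}{q(q^2+q+1)\,|{\rm A\Gamma L}(2,q)|^2}$$ pairwise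 nonisomorphic designs having the same parameters as ${\rm AG}_1(3,q)$, the design of points and lines of ${\rm AG}(3,q)$; that is, $2$-$(q^3,q,1)$-designs. (3) For every $\pi\in{\rm Sym}(X)$, the pointwise stabilizer of $X$ in ${\rm Aut}\,\mathbf D_\pi$ is transitive on the points outside of $X$. (4) For every $\pi\in{\rm Sym}(X)$, the group of permutations of $X$ induced by the setwise stabilizer of $X$ in ${\rm Aut}\,\mathbf D_\pi$ is ${\rm A\Gamma L}(X)\cap{\rm A\Gamma L}(X)^\pi$. -/

import Mathlib

namespace TwistedAffine

/-! Geometries on a point set `P` are given by their sets of blocks, `Set (Set P)`. -/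

/-- `g` is an isomorphism of the geometry with blocks `B` onto the geometry with blocks `B'`. -/
def IsIso {P P' : Type*} (B : Set (Set P)) (B' : Set (Set P')) (g : P ≃ P') : Prop :=
  ∀ S : Set P, S ∈ B ↔ g '' S ∈ B'

/-- Two geometries are isomorphic. -/
def Isomorphic {P P' : Type*} (B : Set (Set P)) (B' : Set (Set P')) : Prop :=
  ∃ g : P ≃ P', IsIso B B' g

/-- The automorphism group of a geometry, as a group of permutations of the points. -/
def autGroup {P : Type*} (B : Set (Set P)) : Subgroup (Equiv.Perm P) where
  carrier := {g | IsIso B B g}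
  mul_mem' := by
    intro g h hg hh S
    rw [hh S, hg (h '' S), Set.image_image]
    rfl
  one_mem' := by
    intro S
    simp
  inv_mem' := by
    intro g hg S
    rw [hg ((g⁻¹ : Equiv.Perm P) '' S), Set.image_image]
    simp

/-- `B` is the set of blocks of a `2`-`(v, k, l)`-design on the point set `P`. -/
def IsTwoDesign {P : Type*} (B : Set (Set P)) (v k l : ℕ) : Prop :=
  Nat.card P = v ∧ (∀ S ∈ B, S.ncard = k) ∧
    ∀ x y : P, x ≠ y → {S | S ∈ B ∧ x ∈ S ∧ y ∈ S}.ncard = l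

/-- The group induced on a set `X` of points by the setwise stabilizer of `X` in the
permutation group `G`. -/
def inducedGroup {P : Type*} (G : Subgroup (Equiv.Perm P)) (X : Set P) :
    Subgroup (Equiv.Perm X) where
  carrier := {h | ∃ g ∈ G, g '' X = X ∧ ∀ x : X, g x = h x}
  mul_mem' := by
    rintro h₁ h₂ ⟨g₁, hg₁, hX₁, e₁⟩ ⟨g₂, hg₂, hX₂, e₂⟩
    refine ⟨g₁ * g₂, G.mul_mem hg₁ hg₂, ?_, fun x => ?_⟩
    · rw [Equiv.Perm.coe_mul, Set.image_comp, hX₂, hX₁]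
    · rw [Equiv.Perm.mul_apply, Equiv.Perm.mul_apply, e₂, e₁]
  one_mem' := ⟨1, G.one_mem, by simp, fun _ => rfl⟩
  inv_mem' := by
    rintro h ⟨g, hg, hX, e⟩
    refine ⟨g⁻¹, G.inv_mem hg, ?_, fun x => ?_⟩
    · conv_lhs => rw [← hX]
      rw [Set.image_image]
      simp
    · rw [Equiv.Perm.inv_eq_iff_eq, e]
      simp

/-- The affine semilinear group `AΓL` of an affine space `P` with direction space `V` over the
field `K`: the permutations of the points whose linear part is an invertible semilinear map `L`
of `V`, with respect to some automorphism `σ` of `K`. -/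
def affineSemilinearGroup (K V P : Type*) [Field K] [AddCommGroup V] [Module K V]
    [AddTorsor V P] : Subgroup (Equiv.Perm P) where
  carrier := {f | ∃ (σ : K ≃+* K) (L : V ≃+ V),
    (∀ (a : K) (v : V), L (a • v) = σ a • L v) ∧ ∀ x y : P, f x -ᵥ f y = L (x -ᵥ y)}
  mul_mem' := by
    rintro f₁ f₂ ⟨σ₁, L₁, h₁, e₁⟩ ⟨σ₂, L₂, h₂, e₂⟩
    refine ⟨σ₂.trans σ₁, L₂.trans L₁, fun a v => ?_, fun x y => ?_⟩
    · simp [h₁, h₂]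
    · simp [e₁, e₂]
  one_mem' := ⟨RingEquiv.refl K, AddEquiv.refl V, by simp, by simp⟩
  inv_mem' := by
    rintro f ⟨σ, L, h, e⟩
    refine ⟨σ.symm, L.symm, fun a v => ?_, fun x y => ?_⟩
    · rw [AddEquiv.symm_apply_eq, h]
      simp
    · rw [AddEquiv.eq_symm_apply, ← e]
      simp

/-- The lines of the affine space `AG(V)`, as sets of points. -/
def affineLines (K V : Type*) [Field K] [AddCommGroup V] [Module K V] : Set (Set V) :=
  {S | ∃ L : AffineSubspace K V, Module.finrank K L.direction = 1 ∧ (L : Set V) = S}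

/-- The image `L^π` of a set `L` under a permutation `π` of the point set `X` (where `L ⊆ X`). -/
def imageUnder {V : Type*} {X : Set V} (π : Equiv.Perm X) (L : Set V) : Set V :=
  {y | ∃ x : X, (x : V) ∈ L ∧ (π x : V) = y}

/-- The blocks of `D_π`: the lines of `AG(V)` not contained in `X`, and the sets `L^π` for the
lines `L` contained in `X`. -/
def twistedBlocks {K V : Type*} [Field K] [AddCommGroup V] [Module K V]
    (X : AffineSubspace K V) (π : Equiv.Perm X) : Set (Set V) :=
  {S | S ∈ affineLines K V ∧ ¬ S ⊆ X} ∪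
    {S | ∃ L ∈ affineLines K V, L ⊆ X ∧ S = imageUnder (X := (X : Set V)) π L}

end TwistedAffine

/-! Everything rests on one description (`exists_isIso_iff`): a permutation `h` of `X` is induced by
an isomorphism `D_π → D_π'` preserving `X` exactly when both `h` and `π'⁻¹ * h * π` lie in `AΓL(X)`.
Maps compose on the left here.

Necessity: the lines outside `X` already determine the lines inside it. When `q > 2`, a line of `X`
can be recovered by projecting a parallel line outside `X` from a further point outside `X`
(`exists_map_line_of_map_line_outside`), so `h` maps lines into lines and the fundamental theorem of
affine geometry for finite planes applies. The blocks inside `X` are `π`-images of lines, which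
gives the same for `π'⁻¹ * h * π`. Sufficiency: `h` extends to a semilinear affine map of the space
(`exists_extension`), with a free choice of image for one outside point; for `h = 1` this freedom is
the transitivity statement. The double coset and stabilizer statements are rewritings.

For the count, an isomorphism `D_π → D_π'` pulls `X` back to a subspace of `D_π` with `q ^ 2`
points. Distinct such subspaces share no triangle, so there are at most `q (q² + q + 1)` of them
(`IsLineFunction.card_le`). The `π'` with the same pullback lie in one double coset, of size at most
`|AΓL|²`. This bounds each isomorphism class among the `(q²)!` permutations. -/

namespace TwistedAffine

/-! ### Fundamental theorem of affine geometry for finite planes -/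

section Fundamental

variable {K W : Type*} [Field K] [AddCommGroup W] [Module K W]

theorem exists_smul_add_smul_eq (hW : Module.finrank K W = 2) {u v : W}
    (h : LinearIndependent K ![u, v]) (x : W) : ∃ a b : K, x = a • u + b • v := by
  have := Module.finite_of_finrank_pos (R := K) (M := W) (by omega)
  have hs := h.span_eq_top_of_card_eq_finrank' (by simp [hW])
  have hx : x ∈ Submodule.span K (Set.range ![u, v]) := hs ▸ Submodule.mem_top
  rw [Matrix.range_cons_cons_empty, Submodule.mem_span_pair] at hx
  obtain ⟨a, b, h⟩ := hx
  exact ⟨a, b, h.symm⟩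

theorem exists_linearIndependent_pair_of_finrank_eq_two (hW : Module.finrank K W = 2) {u : W}
    (hu : u ≠ 0) : ∃ v : W, LinearIndependent K ![u, v] := by
  by_contra! h
  have : Module.finrank K W ≤ 1 := by
    refine finrank_le_one u fun w => ?_
    have h1 := h w
    rw [LinearIndependent.pair_iff' hu] at h1
    push Not at h1
    exact h1
  omega

/-- A bijection of a vector plane fixing `0` and mapping each line into a line maps parallel lines
to parallel lines. -/
theorem exists_map_add_smul_eq [Finite K] (hW : Module.finrank K W = 2) {F : W → W}
    (hF : Function.Injective F) (h0 : F 0 = 0)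
    (hl : ∀ p v : W, v ≠ 0 → ∃ w : W, ∀ t : K, ∃ s : K, F (p + t • v) = F p + s • w)
    (p v : W) (t : K) : ∃ s : K, F (p + t • v) = F p + s • F v := by
  by_cases hv : v = 0
  · exact ⟨0, by simp [hv]⟩
  -- The parameter map `K → K` is injective, hence onto as `K` is finite: the image of a line is a
  -- full line.
  have key : ∀ p : W, ∃ w : W, w ≠ 0 ∧ (∀ t : K, ∃ s : K, F (p + t • v) = F p + s • w) ∧
      ∀ s : K, ∃ t : K, F (p + t • v) = F p + s • w := by
    intro p
    obtain ⟨w, hw⟩ := hl p v hv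
    choose s hs using hw
    have hinj : Function.Injective s := by
      intro t t' h
      have h1 := hF (((hs t).trans (by rw [h])).trans (hs t').symm)
      exact smul_left_injective K hv (add_left_cancel h1)
    refine ⟨w, ?_, fun t => ⟨s t, hs t⟩, fun r => ?_⟩
    · rintro rfl
      have h1 := hF ((hs 1).trans ((by simp : _ = F p + s 0 • (0 : W)).trans (hs 0).symm))
      simp [hv] at h1
    · obtain ⟨t, rfl⟩ := (Finite.injective_iff_surjective.mp hinj) r
      exact ⟨t, hs t⟩
  obtain ⟨w₀, hw₀, h₀, -⟩ := key 0
  have hFv : F v ≠ 0 := fun h => hv (hF (h.trans h0.symm))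
  obtain ⟨c, hc⟩ : ∃ c : K, F v = c • w₀ := by
    obtain ⟨s, hs⟩ := h₀ 1
    exact ⟨s, by simpa [h0] using hs⟩
  have hc0 : c ≠ 0 := by rintro rfl; simp [hc] at hFv
  by_cases hp : ∃ r : K, p = r • v
  · obtain ⟨r, rfl⟩ := hp
    obtain ⟨s, hs⟩ := h₀ r
    obtain ⟨s', hs'⟩ := h₀ (r + t)
    rw [zero_add, h0, zero_add] at hs hs'
    refine ⟨(s' - s) / c, ?_⟩
    rw [← add_smul, hs', hs, hc, smul_smul, div_mul_cancel₀ _ hc0, sub_smul]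
    abel
  · obtain ⟨w, hw, h₁, h₂⟩ := key p
    obtain ⟨w', hw', h₁', h₂'⟩ := key 0
    -- Independent directions would make the two image lines meet, hence also the original lines,
    -- putting `p` on `K v`.
    have hdep : ¬ LinearIndependent K ![w, w'] := by
      intro hli
      obtain ⟨a, b, hab⟩ := exists_smul_add_smul_eq hW hli (F p)
      obtain ⟨t₁, ht₁⟩ := h₂ (-a)
      obtain ⟨t₂, ht₂⟩ := h₂' b
      have : F (p + t₁ • v) = F (0 + t₂ • v) := by
        rw [ht₁, ht₂, h0, zero_add]
        nth_rw 1 [hab]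
        rw [neg_smul]; abel
      have h3 := hF this
      refine hp ⟨t₂ - t₁, ?_⟩
      rw [sub_smul, eq_sub_iff_add_eq, h3, zero_add]
    obtain ⟨d, hd⟩ : ∃ d : K, F v = d • w' := by
      obtain ⟨s, hs⟩ := h₁' 1
      exact ⟨s, by simpa [h0] using hs⟩
    rw [LinearIndependent.pair_iff' hw] at hdep
    push Not at hdep
    obtain ⟨a, ha⟩ := hdep
    obtain ⟨s, hs⟩ := h₁ t
    have hda : d * a ≠ 0 := by
      intro h
      apply hFv
      rw [hd, ← ha, smul_smul, h, zero_smul]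
    refine ⟨s / (d * a), ?_⟩
    rw [hs, hd, ← ha, smul_smul, smul_smul, mul_assoc, div_mul_cancel₀ _ hda]

/-- The fundamental theorem of affine geometry for bijections of a plane fixing the origin. -/
theorem exists_semilinear_of_map_line [Finite K] (hW : Module.finrank K W = 2) (F : W ≃ W)
    (h0 : F 0 = 0)
    (hl : ∀ p v : W, v ≠ 0 → ∃ w : W, ∀ t : K, ∃ s : K, F (p + t • v) = F p + s • w) :
    ∃ σ : K ≃+* K, (∀ u v, F (u + v) = F u + F v) ∧ ∀ (a : K) (v : W), F (a • v) = σ a • F v := by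
  have hpar := exists_map_add_smul_eq hW F.injective h0 hl
  have hne : ∀ v, v ≠ 0 → F v ≠ 0 := fun v hv h => hv (F.injective (h.trans h0.symm))
  have hsm : ∀ (v : W) (t : K), ∃ s : K, F (t • v) = s • F v := fun v t => by
    simpa [h0] using hpar 0 v t
  have hsurj : ∀ (v : W), v ≠ 0 → ∀ s : K, ∃ t : K, F (t • v) = s • F v := by
    intro v hv s
    choose f hf using hsm v
    have hinj : Function.Injective f := by
      intro t t' h
      have h1 := F.injective (((hf t).trans (by rw [h])).trans (hf t').symm)
      exact smul_left_injective K hv h1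
    obtain ⟨t, rfl⟩ := (Finite.injective_iff_surjective.mp hinj) s
    exact ⟨t, hf t⟩
  have hindep : ∀ u v : W, LinearIndependent K ![u, v] → LinearIndependent K ![F u, F v] := by
    intro u v huv
    have hu : u ≠ 0 := huv.ne_zero 0
    rw [LinearIndependent.pair_iff' (hne u hu)]
    intro a ha
    obtain ⟨t, ht⟩ := hsurj u hu a
    rw [LinearIndependent.pair_iff' hu] at huv
    exact huv t (F.injective (ht.trans ha))
  -- Parallelogram: `F (u + v)` lies on `F u + K (F v)` and on `F v + K (F u)`, which meet only in
  -- `F u + F v`.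
  have hadd1 : ∀ u v : W, LinearIndependent K ![u, v] → F (u + v) = F u + F v := by
    intro u v huv
    obtain ⟨s, hs⟩ := hpar u v 1
    obtain ⟨r, hr⟩ := hpar v u 1
    rw [one_smul] at hs hr
    rw [add_comm, hs] at hr
    have h1 := LinearIndependent.pair_iff.mp (hindep u v huv) (1 - r) (s - 1) (by
      rw [sub_smul, sub_smul, one_smul, one_smul]
      linear_combination (norm := module) hr)
    rw [hs, sub_eq_zero.mp h1.2, one_smul]
  have hneg : ∀ w, F (-w) = - F w := by
    intro w
    by_cases hw : w = 0
    · simp [hw, h0]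
    obtain ⟨u, hu⟩ := exists_linearIndependent_pair_of_finrank_eq_two hW hw
    rw [LinearIndependent.pair_iff] at hu
    have h1 := hadd1 u w (by
      rw [LinearIndependent.pair_iff]
      intro a b h
      exact (hu b a (by rw [← h, add_comm])).symm)
    have h2 := hadd1 (u + w) (-w) (by
      rw [LinearIndependent.pair_iff]
      intro a b h
      have := hu (a - b) a (by rw [← h]; module)
      refine ⟨this.2, ?_⟩
      linear_combination this.2 - this.1)
    rw [add_neg_cancel_right, h1] at h2
    linear_combination (norm := module) -h2
  have hadd : ∀ u v : W, F (u + v) = F u + F v := by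
    intro u v
    by_cases huv : LinearIndependent K ![u, v]
    · exact hadd1 u v huv
    by_cases hu : u = 0
    · simp [hu, h0]
    rw [LinearIndependent.pair_iff' hu] at huv
    push Not at huv
    obtain ⟨a, rfl⟩ := huv
    by_cases ha : 1 + a = 0
    · rw [show a • u = -u by rw [eq_neg_of_add_eq_zero_right ha]; simp, hneg, add_neg_cancel,
        add_neg_cancel, h0]
    by_cases ha0 : a = 0
    · simp [ha0, h0]
    obtain ⟨w, hw⟩ := exists_linearIndependent_pair_of_finrank_eq_two hW hu
    have hw' := LinearIndependent.pair_iff.mp hw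
    -- An auxiliary `w` off the line of `u` splits `u + a • u` into two vectors that are independent
    -- because `1 + a ≠ 0`.
    have h1 := hadd1 (u + w) (a • u - w) (by
      rw [LinearIndependent.pair_iff]
      intro b c h
      have := hw' (b + c * a) (b - c) (by rw [← h]; module)
      have hbc := sub_eq_zero.mp this.2
      have hc : c * (1 + a) = 0 := by linear_combination this.1 - this.2
      have hc0 := (mul_eq_zero.mp hc).resolve_right ha
      exact ⟨hbc.trans hc0, hc0⟩)
    have h2 := hadd1 (a • u) (-w) (by
      rw [LinearIndependent.pair_iff]
      intro b c h
      have := hw' (b * a) (-c) (by rw [← h]; module)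
      exact ⟨(mul_eq_zero.mp this.1).resolve_right ha0, neg_eq_zero.mp this.2⟩)
    rw [show u + w + (a • u - w) = u + a • u by abel, hadd1 u w hw, sub_eq_add_neg, h2, hneg] at h1
    rw [h1]; abel
  obtain ⟨e, he⟩ : ∃ e : W, e ≠ 0 := by
    have : Nontrivial W := Module.nontrivial_of_finrank_pos (R := K) (by omega)
    exact exists_ne 0
  choose s hs using hsm
  -- Both scalars agree with that of `u + v`, by comparing coefficients.
  have hss : ∀ u v t, LinearIndependent K ![u, v] → s u t = s v t := by
    intro u v t huv
    have h1 := hs (u + v) t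
    rw [smul_add, hadd, hs u, hs v, hadd] at h1
    have := LinearIndependent.pair_iff.mp (hindep u v huv) (s u t - s (u + v) t)
      (s v t - s (u + v) t) (by linear_combination (norm := module) h1)
    linear_combination this.1 - this.2
  have hse : ∀ (t : K) (v : W), F (t • v) = s e t • F v := by
    intro t v
    by_cases hv : v = 0
    · simp [hv, h0]
    by_cases hev : LinearIndependent K ![e, v]
    · rw [hs v, hss e v t hev]
    · rw [LinearIndependent.pair_iff' he] at hev
      push Not at hev
      obtain ⟨a, rfl⟩ := hev
      have ha : a ≠ 0 := by rintro rfl; simp at hv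
      obtain ⟨w, hw⟩ := exists_linearIndependent_pair_of_finrank_eq_two hW he
      rw [hs _, hss e w t hw, hss (a • e) w t]
      rw [LinearIndependent.pair_iff] at hw ⊢
      intro b c h
      have := hw (b * a) c (by rw [← h]; module)
      exact ⟨(mul_eq_zero.mp this.1).resolve_right ha, this.2⟩
  have hcancel : ∀ a b : K, a • F e = b • F e → a = b := fun a b h =>
    smul_left_injective K (hne e he) h
  let σ : K →+* K :=
    { toFun := s e
      map_one' := hcancel _ _ (by rw [← hse, one_smul, one_smul])
      map_mul' := fun a b => hcancel _ _ (by rw [← hse, mul_smul, hse, hse, mul_smul])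
      map_zero' := hcancel _ _ (by rw [← hse, zero_smul, zero_smul, h0])
      map_add' := fun a b => hcancel _ _ (by rw [← hse, add_smul, hadd, hse, hse, add_smul]) }
  have hσ : Function.Bijective σ := Finite.injective_iff_bijective.mp σ.injective
  exact ⟨RingEquiv.ofBijective σ hσ, hadd, hse⟩

/-- The fundamental theorem of affine geometry for planes over finite fields. -/
theorem mem_affineSemilinearGroup_of_map_line {P : Type*} [AddTorsor W P] [Finite K]
    (hW : Module.finrank K W = 2) (f : Equiv.Perm P)
    (hl : ∀ (p : P) (v : W), v ≠ 0 →
      ∃ w : W, ∀ t : K, ∃ s : K, f (t • v +ᵥ p) = s • w +ᵥ f p) :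
    f ∈ affineSemilinearGroup K W P := by
  obtain ⟨o⟩ : Nonempty P := inferInstance
  let F : W ≃ W := ((Equiv.vaddConst o).trans f).trans (Equiv.vaddConst (f o)).symm
  have hF : ∀ v, F v = f (v +ᵥ o) -ᵥ f o := fun v => rfl
  obtain ⟨σ, hadd, hsm⟩ := exists_semilinear_of_map_line (K := K) hW F (by simp [hF]) (by
    intro p v hv
    obtain ⟨w, hw⟩ := hl (p +ᵥ o) v hv
    refine ⟨w, fun t => ?_⟩
    obtain ⟨s, hs⟩ := hw t
    refine ⟨s, ?_⟩
    rw [hF, hF, add_comm, ← vadd_vadd, hs, vadd_vsub_assoc, add_comm])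
  refine ⟨σ, AddEquiv.mk' F hadd, hsm, fun x y => ?_⟩
  have h1 : F (x -ᵥ o) = F (x -ᵥ y) + F (y -ᵥ o) := by rw [← hadd, vsub_add_vsub_cancel]
  change f x -ᵥ f y = F (x -ᵥ y)
  rw [eq_sub_of_add_eq h1.symm, hF, hF]
  simp

end Fundamental

/-! ### Lines of the space and extension of semilinear maps from a plane -/

section Lines

variable {K V : Type*} [Field K] [AddCommGroup V] [Module K V]

variable (K) in
/-- The line through `p` with direction vector `v`. -/
def line (p v : V) : Set V := Set.range fun t : K => p + t • v

theorem mem_line {p v x : V} : x ∈ line K p v ↔ ∃ t : K, p + t • v = x := Iff.rfl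

theorem left_mem_line (p v : V) : p ∈ line K p v := ⟨0, by simp⟩

theorem mem_affineLines_iff {S : Set V} :
    S ∈ affineLines K V ↔ ∃ p v : V, v ≠ 0 ∧ S = line K p v := by
  constructor
  · rintro ⟨L, hL, rfl⟩
    obtain ⟨p, hp⟩ : (L : Set V).Nonempty := by
      rw [Set.nonempty_iff_ne_empty, Ne, AffineSubspace.coe_eq_bot_iff]
      rintro rfl
      rw [AffineSubspace.direction_bot, finrank_bot] at hL
      omega
    obtain ⟨v, hv, hs⟩ := finrank_eq_one_iff'.mp hL
    refine ⟨p, v, by simpa using hv, ?_⟩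
    ext x
    rw [SetLike.mem_coe, ← AffineSubspace.vsub_right_mem_direction_iff_mem hp, mem_line]
    constructor
    · intro hx
      obtain ⟨c, hc⟩ := hs ⟨_, hx⟩
      refine ⟨c, ?_⟩
      have := congrArg Subtype.val hc
      simp only [SetLike.val_smul, vsub_eq_sub] at this
      rw [this]; abel
    · rintro ⟨t, rfl⟩
      simpa using L.direction.smul_mem t v.2
  · rintro ⟨p, v, hv, rfl⟩
    refine ⟨AffineSubspace.mk' p (Submodule.span K {v}), ?_, ?_⟩
    · rw [AffineSubspace.direction_mk', finrank_span_singleton hv]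
    · ext x
      rw [SetLike.mem_coe, AffineSubspace.mem_mk', Submodule.mem_span_singleton, mem_line]
      simp only [vsub_eq_sub, eq_sub_iff_add_eq, add_comm]

theorem line_mem_affineLines (p : V) {v : V} (hv : v ≠ 0) : line K p v ∈ affineLines K V :=
  mem_affineLines_iff.mpr ⟨p, v, hv, rfl⟩

theorem line_injective (p : V) {v : V} (hv : v ≠ 0) :
    Function.Injective fun t : K => p + t • v :=
  fun _ _ h => smul_left_injective K hv (add_left_cancel h)

theorem ncard_of_mem_affineLines {S : Set V} (hS : S ∈ affineLines K V) :
    S.ncard = Nat.card K := by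
  obtain ⟨p, v, hv, rfl⟩ := mem_affineLines_iff.mp hS
  exact (Nat.card_coe_set_eq _).symm.trans (Nat.card_range_of_injective (line_injective p hv))

theorem line_eq_of_mem {p v x y : V} (hx : x ∈ line K p v) (hy : y ∈ line K p v) (hxy : x ≠ y) :
    line K p v = line K x (y - x) := by
  obtain ⟨a, rfl⟩ := hx
  obtain ⟨b, rfl⟩ := hy
  have hab : b - a ≠ 0 := by
    intro h
    rw [sub_eq_zero.mp h] at hxy
    exact hxy rfl
  have e : (p + b • v) - (p + a • v) = (b - a) • v := by module
  simp only [e]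
  ext z
  constructor
  · rintro ⟨t, rfl⟩
    refine ⟨(t - a) / (b - a), ?_⟩
    simp only [smul_smul, div_mul_cancel₀ _ hab]
    module
  · rintro ⟨t, rfl⟩
    exact ⟨a + t * (b - a), by module⟩

theorem eq_line_of_mem_affineLines {S : Set V} (hS : S ∈ affineLines K V) {x y : V} (hx : x ∈ S)
    (hy : y ∈ S) (hxy : x ≠ y) : S = line K x (y - x) := by
  obtain ⟨p, v, -, rfl⟩ := mem_affineLines_iff.mp hS
  exact line_eq_of_mem hx hy hxy

theorem right_mem_line (x y : V) : y ∈ line K x (y - x) := ⟨1, by simp⟩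

theorem image_mem_affineLines {g : Equiv.Perm V} (hg : g ∈ affineSemilinearGroup K V V)
    {S : Set V} (hS : S ∈ affineLines K V) : g '' S ∈ affineLines K V := by
  obtain ⟨σ, L, hL, e⟩ := hg
  obtain ⟨p, v, hv, rfl⟩ := mem_affineLines_iff.mp hS
  have hp : ∀ t : K, g (p + t • v) = g p + σ t • L v := fun t => by
    have := e (p + t • v) p
    rw [vsub_eq_sub, vsub_eq_sub, add_sub_cancel_left, hL] at this
    rw [← this]; abel
  refine mem_affineLines_iff.mpr ⟨g p, L v, by simpa using hv, ?_⟩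
  ext x
  constructor
  · rintro ⟨_, ⟨t, rfl⟩, rfl⟩
    exact ⟨σ t, (hp t).symm⟩
  · rintro ⟨t, rfl⟩
    exact ⟨_, ⟨σ.symm t, rfl⟩, by simp [hp]⟩

variable {X : AffineSubspace K V}

theorem line_subset {p v : V} (hp : p ∈ X) (hv : v ∈ X.direction) : line K p v ⊆ X := by
  rintro _ ⟨t, rfl⟩
  have := AffineSubspace.vadd_mem_of_mem_direction (X.direction.smul_mem t hv) hp
  rwa [vadd_eq_add, add_comm] at this

theorem sub_mem_direction {x y : V} (hx : x ∈ X) (hy : y ∈ X) : x - y ∈ X.direction :=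
  AffineSubspace.vsub_mem_direction hx hy

theorem sub_notMem_direction {x y : V} (hx : x ∉ X) (hy : y ∈ X) : x - y ∉ X.direction := by
  rwa [← vsub_eq_sub, AffineSubspace.vsub_right_mem_direction_iff_mem hy]

theorem image_coe_mem_affineLines [Nonempty X] {h : Equiv.Perm X}
    (hh : h ∈ affineSemilinearGroup K X.direction X) {L : Set V} (hL : L ∈ affineLines K V)
    (hLX : L ⊆ X) : imageUnder (X := (X : Set V)) h L ∈ affineLines K V := by
  obtain ⟨σ, A, hA, e⟩ := hh
  obtain ⟨p, v, hv, rfl⟩ := mem_affineLines_iff.mp hL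
  have hpX : p ∈ X := hLX (left_mem_line p v)
  have hvX : v ∈ X.direction := by
    have := sub_mem_direction (hLX ⟨1, rfl⟩) hpX
    simpa using this
  let p' : X := ⟨p, hpX⟩
  let v' : X.direction := ⟨v, hvX⟩
  have hp : ∀ t : K, h (t • v' +ᵥ p') = σ t • A v' +ᵥ h p' := fun t => by
    rw [eq_vadd_iff_vsub_eq, e, vadd_vsub, hA]
  have hc : ∀ t : K, ((t • v' +ᵥ p' : X) : V) = p + t • v := fun t => by
    simp [AffineSubspace.coe_vadd, v', p', add_comm]
  have hc' : ∀ t : K, ((t • A v' +ᵥ h p' : X) : V) = h p' + t • (A v' : V) := fun t => by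
    simp [AffineSubspace.coe_vadd, add_comm]
  refine mem_affineLines_iff.mpr ⟨h p', A v', by simpa [v'] using hv, ?_⟩
  ext x
  constructor
  · rintro ⟨y, ⟨t, ht⟩, rfl⟩
    obtain rfl : y = t • v' +ᵥ p' := Subtype.ext (ht.symm.trans (hc t).symm)
    exact ⟨σ t, by rw [hp, hc']⟩
  · rintro ⟨t, rfl⟩
    refine ⟨σ.symm t • v' +ᵥ p', ⟨σ.symm t, (hc _).symm⟩, ?_⟩
    rw [hp, hc', RingEquiv.apply_symm_apply]

theorem exists_prod_linearEquiv (hV : Module.finrank K V = 3)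
    (hX : Module.finrank K X.direction = 2) {n : V} (hn : n ∉ X.direction) :
    ∃ e : (X.direction × K) ≃ₗ[K] V, ∀ w a, e (w, a) = w + a • n := by
  have := Module.finite_of_finrank_pos (R := K) (M := V) (by omega)
  let f : (X.direction × K) →ₗ[K] V :=
    X.direction.subtype.coprod (LinearMap.toSpanSingleton K V n)
  have hf : ∀ w a, f (w, a) = w + a • n := fun w a => by simp [f]
  have hinj : Function.Injective f := by
    rw [injective_iff_map_eq_zero]
    rintro ⟨w, a⟩ h
    rw [hf] at h
    by_cases ha : a = 0
    · subst ha
      simpa using h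
    · refine absurd ?_ hn
      have h1 : n = a⁻¹ • (-(w : V)) := by
        rw [← eq_neg_of_add_eq_zero_right h, smul_smul, inv_mul_cancel₀ ha, one_smul]
      rw [h1]
      exact X.direction.smul_mem _ (X.direction.neg_mem w.2)
  exact ⟨LinearEquiv.ofInjectiveOfFinrankEq f hinj (by simp [hX, hV]), hf⟩

/-- Every affine semilinear transformation of a plane `X` extends to the space, with any prescribed
image outside `X` of a point outside `X`. -/
theorem exists_extension [Nonempty X] (hV : Module.finrank K V = 3)
    (hX : Module.finrank K X.direction = 2) {h : Equiv.Perm X}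
    (hh : h ∈ affineSemilinearGroup K X.direction X) {x y : V} (hx : x ∉ X) (hy : y ∉ X) :
    ∃ g ∈ affineSemilinearGroup K V V, (∀ z : X, g z = h z) ∧ g x = y := by
  obtain ⟨σ, A, hA, e⟩ := hh
  obtain ⟨o⟩ := ‹Nonempty X›
  obtain ⟨e₁, he₁⟩ := exists_prod_linearEquiv hV hX (sub_notMem_direction hx o.2)
  obtain ⟨e₂, he₂⟩ := exists_prod_linearEquiv hV hX (sub_notMem_direction hy (h o).2)
  -- In the decompositions `V = X.direction ⊕ K (x - o)` and `V = X.direction ⊕ K (y - h o)`, take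
  -- `A` on the plane and `σ` on the complement, so that the sum is again `σ`-semilinear.
  let B : V ≃+ V := (e₁.symm.toAddEquiv.trans (A.prodCongr σ.toAddEquiv)).trans e₂.toAddEquiv
  have hB : ∀ w a, B (e₁ (w, a)) = e₂ (A w, σ a) := fun w a => by
    simp only [B, AddEquiv.trans_apply]
    simp
    rfl
  let g : Equiv.Perm V :=
    ((Equiv.subRight (o : V)).trans B.toEquiv).trans (Equiv.addRight (h o : V))
  have hg : ∀ z, g z = B (z - o) + h o := fun z => rfl
  refine ⟨g, ⟨σ, B, fun a v => ?_, fun x y => ?_⟩, fun z => ?_, ?_⟩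
  · obtain ⟨⟨w, b⟩, rfl⟩ := e₁.surjective v
    rw [← map_smul, Prod.smul_mk, hB, hB, ← map_smul, Prod.smul_mk, hA, smul_eq_mul, smul_eq_mul,
      map_mul]
  · rw [hg, hg, vsub_eq_sub, vsub_eq_sub, add_sub_add_right_eq_sub, ← map_sub,
      sub_sub_sub_cancel_right]
  · have h1 : (z : V) - o = e₁ (z -ᵥ o, 0) := by simp [he₁]
    rw [hg, h1, hB, ← e, he₂]
    simp
  · have h1 : x - o = e₁ (0, 1) := by simp [he₁]
    rw [hg, h1, hB, he₂]
    simp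

end Lines

/-! ### Permutations of a subset acting on its subsets -/

section Permutations

variable {V : Type*}

theorem imageUnder_subset {Y : Set V} (π : Equiv.Perm Y) (L : Set V) : imageUnder π L ⊆ Y := by
  rintro _ ⟨x, -, rfl⟩
  exact (π x).2

theorem imageUnder_mul {Y : Set V} (π ρ : Equiv.Perm Y) (L : Set V) :
    imageUnder (π * ρ) L = imageUnder π (imageUnder ρ L) := by
  ext y
  constructor
  · rintro ⟨x, hx, rfl⟩
    exact ⟨ρ x, ⟨x, hx, rfl⟩, rfl⟩
  · rintro ⟨_, ⟨x, hx, h⟩, rfl⟩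
    obtain rfl := Subtype.ext h
    exact ⟨x, hx, rfl⟩

theorem imageUnder_one {Y L : Set V} (hL : L ⊆ Y) : imageUnder (1 : Equiv.Perm Y) L = L := by
  ext y
  constructor
  · rintro ⟨x, hx, rfl⟩
    exact hx
  · exact fun hy => ⟨⟨y, hL hy⟩, hy, rfl⟩

theorem image_eq_imageUnder {Y L : Set V} (hL : L ⊆ Y) {g : Equiv.Perm V} {h : Equiv.Perm Y}
    (hg : ∀ z : Y, g z = h z) : g '' L = imageUnder h L := by
  ext y
  constructor
  · rintro ⟨x, hx, rfl⟩
    exact ⟨⟨x, hL hx⟩, hx, (hg ⟨x, hL hx⟩).symm⟩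
  · rintro ⟨x, hx, rfl⟩
    exact ⟨x, hx, hg x⟩

theorem mem_iff_of_image_eq {Y : Set V} {g : Equiv.Perm V} (hg : g '' Y = Y) (z : V) :
    g z ∈ Y ↔ z ∈ Y := by
  conv_lhs => rw [← hg]
  exact g.injective.mem_set_image

theorem image_eq_of_forall {g : Equiv.Perm V} {Y : Set V} {h : Equiv.Perm Y}
    (hgh : ∀ z : Y, g z = h z) : g '' Y = Y := by
  ext y
  constructor
  · rintro ⟨x, hx, rfl⟩
    rw [hgh ⟨x, hx⟩]
    exact (h _).2
  · intro hy
    refine ⟨h⁻¹ ⟨y, hy⟩, Subtype.coe_prop _, ?_⟩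
    rw [hgh]
    simp

theorem exists_perm_of_image_eq {g : Equiv.Perm V} {Y : Set V} (hg : g '' Y = Y) :
    ∃ h : Equiv.Perm Y, ∀ z : Y, g z = h z :=
  ⟨g.subtypePerm (p := fun z => z ∈ Y) (mem_iff_of_image_eq hg), fun _ => rfl⟩

end Permutations

/-! ### Isomorphisms preserving the plane -/

section Isomorphisms

variable {K V : Type*} [Field K] [AddCommGroup V] [Module K V] {X : AffineSubspace K V}

theorem exists_ne_zero_ne_one (hK : 2 < Nat.card K) : ∃ c : K, c ≠ 0 ∧ c ≠ 1 := by
  by_contra! h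
  have : (Set.univ : Set K) ⊆ {0, 1} := fun c _ => by
    by_cases hc : c = 0
    · exact Or.inl hc
    · exact Or.inr (h c hc)
  have h1 := Set.ncard_le_ncard this
  rw [Set.ncard_univ] at h1
  have h2 := Set.ncard_insert_le (0 : K) {1}
  rw [Set.ncard_singleton] at h2
  omega

/-- A permutation preserving a plane `X` and mapping the lines not in `X` to lines maps the lines
in `X` into lines. -/
theorem exists_map_line_of_map_line_outside (hK : 2 < Nat.card K) (hV : Module.finrank K V = 3)
    (hX : Module.finrank K X.direction = 2) {g : Equiv.Perm V} (hgX : g '' (X : Set V) = X)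
    (hg : ∀ S ∈ affineLines K V, ¬ S ⊆ X → g '' S ∈ affineLines K V)
    {p v : V} (hp : p ∈ X) (hv : v ∈ X.direction) (hv0 : v ≠ 0) :
    ∃ w ∈ X.direction, ∀ t : K, ∃ s : K, g (p + t • v) = g p + s • w := by
  have := Module.finite_of_finrank_pos (R := K) (M := V) (by omega)
  have hmem : ∀ z, g z ∈ X ↔ z ∈ X := mem_iff_of_image_eq hgX
  obtain ⟨n, hn⟩ : ∃ n, n ∉ X.direction := by
    by_contra! h
    have : X.direction = ⊤ := eq_top_iff.mpr fun x _ => h x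
    rw [this, finrank_top] at hX
    omega
  -- The centre of projection `p + c • n` must avoid `X` (`c ≠ 0`) and the line `p + n + K v` (`c ≠
  -- 1`); this needs `q > 2`.
  obtain ⟨c, hc0, hc1⟩ := exists_ne_zero_ne_one hK
  have hc1' : 1 - c ≠ 0 := sub_ne_zero.mpr (Ne.symm hc1)
  have hout : ∀ a : K, a ≠ 0 → p + a • n ∉ X := by
    intro a ha h
    have h1 := sub_mem_direction h hp
    rw [add_sub_cancel_left] at h1
    exact hn ((X.direction.smul_mem_iff ha).mp h1)
  have hn1 : p + n ∉ X := by simpa using hout 1 one_ne_zero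
  obtain ⟨b, w, hw, hbw⟩ := mem_affineLines_iff.mp (hg _ (line_mem_affineLines (p + n) hv0)
    fun h => hn1 (h (left_mem_line _ _)))
  obtain ⟨t₀, ht₀⟩ : g (p + n) ∈ line K b w := hbw ▸ Set.mem_image_of_mem g (left_mem_line _ _)
  set a : V := g (p + n) - g (p + c • n) with ha
  have key : ∀ r : K, g (p + r • v) - g (p + c • n) ∈ Submodule.span K {a, w} := by
    intro r
    -- Chosen so that the line from the centre to `p + n + t • v` meets `X` in `p + r • v`.
    set t := -(r * (1 - c) / c) with ht
    have hd : (1 - c) • n + t • v ≠ 0 := by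
      intro h
      apply hn
      have h1 : (1 - c) • n = -(t • v) := eq_neg_of_add_eq_zero_left h
      exact (X.direction.smul_mem_iff hc1').mp
        (h1 ▸ X.direction.neg_mem (X.direction.smul_mem _ hv))
    have hline := hg _ (line_mem_affineLines (p + c • n) hd)
      fun h => hout c hc0 (h (left_mem_line _ _))
    have m0 := Set.mem_image_of_mem g (left_mem_line (K := K) (p + c • n) ((1 - c) • n + t • v))
    have m1 : g (p + n + t • v) ∈ g '' line K (p + c • n) ((1 - c) • n + t • v) :=
      Set.mem_image_of_mem g ⟨1, by module⟩
    have m2 : g (p + r • v) ∈ g '' line K (p + c • n) ((1 - c) • n + t • v) := by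
      refine Set.mem_image_of_mem g ⟨-(c / (1 - c)), ?_⟩
      have e1 : -(c / (1 - c)) * (1 - c) = -c := by field_simp
      have e2 : -(c / (1 - c)) * t = r := by rw [ht]; field_simp
      simp only [smul_add, smul_smul, e1, e2]
      module
    have hne : g (p + c • n) ≠ g (p + n + t • v) := by
      intro h
      apply hd
      have h1 := g.injective h
      rw [add_assoc] at h1
      have h2 := add_left_cancel h1
      have : (1 - c) • n + t • v = (n + t • v) - c • n := by module
      rw [this, ← h2, sub_self]
    rw [eq_line_of_mem_affineLines hline m0 m1 hne] at m2
    obtain ⟨μ, hμ⟩ := m2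
    obtain ⟨t₁, ht₁⟩ : g (p + n + t • v) ∈ line K b w :=
      hbw ▸ Set.mem_image_of_mem g ⟨t, rfl⟩
    rw [← hμ, Submodule.mem_span_pair]
    refine ⟨μ, μ * (t₁ - t₀), ?_⟩
    rw [ha, ← ht₁, ← ht₀]
    module
  -- The image lies in a translate of `span {a, w}`, of dimension at most 2. This span is not inside
  -- `X.direction`, since it contains `g p - g (p + c • n)` and `g (p + c • n) ∉ X`; so it cuts
  -- `X.direction` in dimension at most 1.
  have hlt : X.direction ⊓ Submodule.span K {a, w} < Submodule.span K {a, w} := by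
    refine lt_of_le_of_ne inf_le_right fun h => ?_
    have h1 := key 0
    rw [← h, zero_smul, add_zero] at h1
    have h2 := sub_notMem_direction (X := X) (mt (hmem _).mp (hout c hc0)) ((hmem p).mpr hp)
    exact h2 (by simpa using X.direction.neg_mem h1.1)
  have hfin : Module.finrank K ↥(X.direction ⊓ Submodule.span K {a, w}) ≤ 1 := by
    have h1 := Submodule.finrank_lt_finrank_of_lt hlt
    have h2 : Module.finrank K ↥(Submodule.span K ({a, w} : Set V)) ≤ 2 := by
      classical
      have := finrank_span_finset_le_card (R := K) ({a, w} : Finset V)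
      rw [Finset.coe_pair] at this
      exact this.trans Finset.card_le_two
    omega
  obtain ⟨u, hu⟩ := finrank_le_one_iff.mp hfin
  refine ⟨u, u.2.1, fun t => ?_⟩
  have hmem1 : g (p + t • v) - g p ∈ X.direction ⊓ Submodule.span K {a, w} := by
    refine ⟨sub_mem_direction ((hmem _).mpr (line_subset hp hv ⟨t, rfl⟩)) ((hmem _).mpr hp), ?_⟩
    have h1 := Submodule.sub_mem _ (key t) (key 0)
    simpa using h1
  obtain ⟨s, hs⟩ := hu ⟨_, hmem1⟩
  refine ⟨s, ?_⟩
  have := congrArg Subtype.val hs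
  simp only [Submodule.coe_smul] at this
  rw [this]; abel

theorem mem_affineSemilinearGroup_of_map_line_coe [Finite K] [Nonempty X]
    (hX : Module.finrank K X.direction = 2) {h : Equiv.Perm X}
    (hl : ∀ (p : X) (v : V), v ∈ X.direction → v ≠ 0 → ∃ w ∈ X.direction, ∀ (t : K) (z : X),
      (z : V) = p + t • v → ∃ s : K, (h z : V) = h p + s • w) :
    h ∈ affineSemilinearGroup K X.direction X := by
  refine mem_affineSemilinearGroup_of_map_line hX h fun p v hv => ?_
  obtain ⟨w, hw, hs⟩ := hl p v v.2 (by simpa using hv)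
  refine ⟨⟨w, hw⟩, fun t => ?_⟩
  obtain ⟨s, hs⟩ := hs t (t • v +ᵥ p) (by simp [AffineSubspace.coe_vadd, add_comm])
  exact ⟨s, Subtype.ext (by simp [AffineSubspace.coe_vadd, add_comm, hs])⟩

/-- Blocks are mapped to blocks by extensions of suitable affine semilinear transformations. -/
theorem image_mem_twistedBlocks [Nonempty X] {π π' h : Equiv.Perm X} {g : Equiv.Perm V}
    (hg : g ∈ affineSemilinearGroup K V V) (hgh : ∀ z : X, g z = h z)
    (hgX : g '' (X : Set V) = X) (hk : π'⁻¹ * h * π ∈ affineSemilinearGroup K X.direction X)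
    {S : Set V} (hS : S ∈ twistedBlocks X π) : g '' S ∈ twistedBlocks X π' := by
  rcases hS with ⟨hS, hSX⟩ | ⟨L, hL, hLX, rfl⟩
  · refine Or.inl ⟨image_mem_affineLines hg hS, fun h => hSX fun z hz => ?_⟩
    exact (mem_iff_of_image_eq hgX z).mp (h (Set.mem_image_of_mem g hz))
  -- With `k = π'⁻¹ * h * π`, one has `h * π = π' * k`, so the image of `L^π` is the `π'`-image of
  -- the line `k L`.
  · refine Or.inr ⟨_, image_coe_mem_affineLines hk hL hLX,
      imageUnder_subset (Y := (X : Set V)) _ _, ?_⟩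
    rw [image_eq_imageUnder (imageUnder_subset (Y := (X : Set V)) _ _) hgh,
      ← imageUnder_mul (Y := (X : Set V)),
      ← imageUnder_mul (Y := (X : Set V))]
    congr 1
    group

theorem isIso_of_mem [Nonempty X] {π π' h : Equiv.Perm X} {g : Equiv.Perm V}
    (hg : g ∈ affineSemilinearGroup K V V) (hgh : ∀ z : X, g z = h z)
    (hk : π'⁻¹ * h * π ∈ affineSemilinearGroup K X.direction X) :
    IsIso (twistedBlocks X π) (twistedBlocks X π') g := by
  have hgX : g '' (X : Set V) = X := image_eq_of_forall (Y := (X : Set V)) hgh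
  refine fun S => ⟨image_mem_twistedBlocks hg hgh hgX hk, fun hS => ?_⟩
  have hgh' : ∀ z : X, g⁻¹ (z : V) = (h⁻¹ z : X) := fun z => by
    rw [Equiv.Perm.inv_eq_iff_eq, hgh]
    simp
  have h1 := image_mem_twistedBlocks (π := π') (π' := π) (h := h⁻¹) (inv_mem hg) hgh'
    (image_eq_of_forall (Y := (X : Set V)) hgh') (by
      have := inv_mem hk
      simpa [mul_assoc] using this) hS
  rw [Set.image_image] at h1
  simpa using h1

/-- A line not in `X` goes to a block not in `X`, hence to a line, and projection recovers the lines
of `X`; this handles `h`. A block `π L` in `X` goes to some `π' L'`, so `π'⁻¹ * h * π` takes `L` to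
`L'`. -/
theorem mem_of_isIso [Nonempty X] (hK : 2 < Nat.card K) (hV : Module.finrank K V = 3)
    (hX : Module.finrank K X.direction = 2) {π π' h : Equiv.Perm X} {g : Equiv.Perm V}
    (hg : IsIso (twistedBlocks X π) (twistedBlocks X π') g) (hgh : ∀ z : X, g z = h z) :
    h ∈ affineSemilinearGroup K X.direction X ∧
      π'⁻¹ * h * π ∈ affineSemilinearGroup K X.direction X := by
  have : Finite K := Nat.finite_of_card_ne_zero (by omega)
  have hgX : g '' (X : Set V) = X := image_eq_of_forall (Y := (X : Set V)) hgh
  constructor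
  · refine mem_affineSemilinearGroup_of_map_line_coe hX fun p v hv hv0 => ?_
    obtain ⟨w, hw, hs⟩ := exists_map_line_of_map_line_outside hK hV hX hgX (fun S hS hSX => by
      rcases (hg S).mp (Or.inl ⟨hS, hSX⟩) with h1 | ⟨L, -, -, h1⟩
      · exact h1.1
      · refine absurd (fun z hz => ?_) hSX
        have h2 : g '' S ⊆ X := h1 ▸ imageUnder_subset (Y := (X : Set V)) _ _
        exact (mem_iff_of_image_eq hgX z).mp (h2 (Set.mem_image_of_mem g hz))) p.2 hv hv0
    refine ⟨w, hw, fun t z hz => ?_⟩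
    obtain ⟨s, hs⟩ := hs t
    refine ⟨s, ?_⟩
    rw [← hgh, hz, hs, hgh]
  · refine mem_affineSemilinearGroup_of_map_line_coe hX fun p v hv hv0 => ?_
    have hLX := line_subset (K := K) p.2 hv
    have h1 := (hg _).mp (Or.inr ⟨_, line_mem_affineLines (p : V) hv0, hLX, rfl⟩)
    rw [image_eq_imageUnder (imageUnder_subset (Y := (X : Set V)) _ _) hgh,
      ← imageUnder_mul (Y := (X : Set V))] at h1
    rcases h1 with ⟨-, h1⟩ | ⟨L, hL, hLX', h1⟩
    · exact absurd (imageUnder_subset (Y := (X : Set V)) _ _) h1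
    · have h2 : imageUnder (X := (X : Set V)) (π'⁻¹ * h * π) (line K (p : V) v) = L := by
        rw [mul_assoc, imageUnder_mul (Y := (X : Set V)), h1, ← imageUnder_mul (Y := (X : Set V)),
          inv_mul_cancel,
          imageUnder_one (Y := (X : Set V)) hLX']
      have hm : ∀ (t : K) (z : X), (z : V) = p + t • v → ((π'⁻¹ * h * π) z : V) ∈ L :=
        fun t z hz => h2 ▸ ⟨z, ⟨t, hz.symm⟩, rfl⟩
      have hp := hm 0 p (by simp)
      obtain ⟨b, w, hw, rfl⟩ := mem_affineLines_iff.mp hL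
      have hwX : w ∈ X.direction := by
        have := sub_mem_direction (hLX' ⟨1, rfl⟩) (hLX' (left_mem_line _ _))
        simpa using this
      refine ⟨w, hwX, fun t z hz => ?_⟩
      obtain ⟨s₀, hs₀⟩ := hp
      obtain ⟨s₁, hs₁⟩ := hm t z hz
      refine ⟨s₁ - s₀, ?_⟩
      rw [← hs₁, ← hs₀]
      module

theorem exists_notMem (hV : Module.finrank K V = 3) [Nonempty X]
    (hX : Module.finrank K X.direction = 2) : ∃ x, x ∉ X := by
  by_contra! h
  have h1 : X = ⊤ := by ext x; simp [h x]
  subst h1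
  rw [AffineSubspace.direction_top, finrank_top] at hX
  omega

/-- The permutations of `X` induced by isomorphisms `D_π → D_π'` preserving `X`. -/
theorem exists_isIso_iff [Nonempty X] (hK : 2 < Nat.card K) (hV : Module.finrank K V = 3)
    (hX : Module.finrank K X.direction = 2) (π π' h : Equiv.Perm X) :
    (∃ g : Equiv.Perm V, IsIso (twistedBlocks X π) (twistedBlocks X π') g ∧ ∀ z : X, g z = h z) ↔
      h ∈ affineSemilinearGroup K X.direction X ∧
        π'⁻¹ * h * π ∈ affineSemilinearGroup K X.direction X := by
  constructor
  · rintro ⟨g, hg, hgh⟩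
    exact mem_of_isIso hK hV hX hg hgh
  · rintro ⟨hh, hk⟩
    obtain ⟨x, hx⟩ := exists_notMem (X := X) hV hX
    obtain ⟨g, hg, hgh, -⟩ := exists_extension hV hX hh hx hx
    exact ⟨g, isIso_of_mem hg hgh hk, hgh⟩

/-- Putting `k = π'⁻¹ * h * π` turns the criterion into `π' = h * π * k⁻¹` with both outer factors
in `AΓL(X)`. -/
theorem exists_isIso_image_eq_iff [Nonempty X] (hK : 2 < Nat.card K)
    (hV : Module.finrank K V = 3) (hX : Module.finrank K X.direction = 2) (π π' : Equiv.Perm X) :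
    (∃ g : Equiv.Perm V, IsIso (twistedBlocks X π) (twistedBlocks X π') g ∧
        g '' (X : Set V) = X) ↔
      π' ∈ DoubleCoset.doubleCoset π
        (affineSemilinearGroup K X.direction X : Set (Equiv.Perm X))
        (affineSemilinearGroup K X.direction X : Set (Equiv.Perm X)) := by
  rw [DoubleCoset.mem_doubleCoset]
  constructor
  · rintro ⟨g, hg, hgX⟩
    obtain ⟨h, hgh⟩ := exists_perm_of_image_eq hgX
    obtain ⟨hh, hk⟩ := mem_of_isIso hK hV hX hg hgh
    exact ⟨h, hh, _, inv_mem hk, by group⟩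
  · rintro ⟨h, hh, k, hk, e⟩
    obtain ⟨g, hg, hgh⟩ := (exists_isIso_iff hK hV hX π π' h).mpr ⟨hh, by
      rw [e]
      convert inv_mem hk using 1
      group⟩
    exact ⟨g, hg, image_eq_of_forall (Y := (X : Set V)) hgh⟩

end Isomorphisms

/-! ### Counting subspaces of a linear space -/

section LinearSpace

variable {P : Type*} [DecidableEq P] {q : ℕ} {B : P → P → Finset P}

/-- `B x y` is the line joining `x` and `y`, for distinct points `x` and `y` of a linear space all
of whose lines have `q` points. -/
structure IsLineFunction (B : P → P → Finset P) (q : ℕ) : Prop where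
  left_mem : ∀ x y, x ≠ y → x ∈ B x y
  right_mem : ∀ x y, x ≠ y → y ∈ B x y
  card_eq : ∀ x y, x ≠ y → (B x y).card = q
  eq_of_mem : ∀ x y, x ≠ y → ∀ z ∈ B x y, ∀ w ∈ B x y, z ≠ w → B z w = B x y

/-- A set of points containing the line through any two of its points. -/
def IsLineClosed (B : P → P → Finset P) (Y : Finset P) : Prop :=
  ∀ x ∈ Y, ∀ y ∈ Y, x ≠ y → B x y ⊆ Y

/-- The lines joining `z` to the points of `T` are distinct, so they pairwise share only `z`, and
each adds `q - 1` points of `S`. -/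
theorem IsLineFunction.one_add_card_mul_le (hB : IsLineFunction B q) {S T : Finset P}
    (hS : IsLineClosed B S) (hTS : T ⊆ S) {z : P} (hz : z ∈ S) (hzT : z ∉ T)
    (hT : ∀ t ∈ T, ∀ t' ∈ T, t' ∈ B z t → t' = t) : 1 + T.card * (q - 1) ≤ S.card := by
  have hne : ∀ t ∈ T, z ≠ t := fun t ht h => hzT (h ▸ ht)
  have hdisj : ∀ t ∈ T, ∀ t' ∈ T, t ≠ t' → Disjoint ((B z t).erase z) ((B z t').erase z) := by
    intro t ht t' ht' htt'
    rw [Finset.disjoint_left]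
    intro x hx hx'
    rw [Finset.mem_erase] at hx hx'
    have h1 := hB.eq_of_mem z t (hne t ht) z (hB.left_mem z t (hne t ht)) x hx.2 hx.1.symm
    have h2 := hB.eq_of_mem z t' (hne t' ht') z (hB.left_mem z t' (hne t' ht')) x hx'.2 hx'.1.symm
    refine htt' (hT t ht t' ht' ?_).symm
    rw [← h1, h2]
    exact hB.right_mem z t' (hne t' ht')
  have hcard := Finset.card_biUnion hdisj
  rw [Finset.sum_congr rfl (fun t ht => by
    rw [Finset.card_erase_of_mem (hB.left_mem z t (hne t ht)), hB.card_eq z t (hne t ht)]),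
    Finset.sum_const, smul_eq_mul] at hcard
  have hsub : (T.biUnion fun t => (B z t).erase z) ⊆ S.erase z := by
    intro x hx
    obtain ⟨t, ht, hx⟩ := Finset.mem_biUnion.mp hx
    rw [Finset.mem_erase] at hx ⊢
    exact ⟨hx.1, hS z hz t (hTS ht) (hne t ht) hx.2⟩
  have h1 := Finset.card_le_card hsub
  rw [hcard, Finset.card_erase_of_mem hz] at h1
  have := Finset.card_pos.mpr ⟨z, hz⟩
  omega

/-- Joining `c` to the line `B a b` gives `|Y ∩ Y'| ≥ 1 + q (q - 1)`. A point of `Y` outside the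
intersection, joined to all of it, would force `|Y| ≥ 1 + (1 + q (q - 1)) (q - 1)`, which exceeds `q
^ 2` once `q > 2` (equality holds at `q = 2`). -/
theorem IsLineFunction.eq_of_mem_triangle (hB : IsLineFunction B q) (hq : 2 < q)
    {Y Y' : Finset P} (hY : IsLineClosed B Y) (hY' : IsLineClosed B Y') (hc : Y.card = q ^ 2)
    (hc' : Y'.card = q ^ 2) {a b c : P} (ha : a ∈ Y ∩ Y') (hb : b ∈ Y ∩ Y') (hc₁ : c ∈ Y ∩ Y')
    (hab : a ≠ b) (hcab : c ∉ B a b) : Y = Y' := by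
  have hS : IsLineClosed B (Y ∩ Y') := fun x hx y hy hxy => by
    rw [Finset.mem_inter] at hx hy
    exact Finset.subset_inter (hY x hx.1 y hy.1 hxy) (hY' x hx.2 y hy.2 hxy)
  have h1 := hB.one_add_card_mul_le hS (hS a ha b hb hab) hc₁ hcab (fun t ht t' ht' h => by
    by_contra hne
    have hct : c ≠ t := fun h => hcab (h ▸ ht)
    have h1 := hB.eq_of_mem a b hab t' ht' t ht hne
    have h2 := hB.eq_of_mem c t hct t' h t (hB.right_mem c t hct) hne
    rw [← h1, h2] at hcab
    exact hcab (hB.left_mem c t hct))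
  rw [hB.card_eq a b hab] at h1
  have hsub : Y ⊆ Y ∩ Y' := by
    intro z hz
    by_contra hzS
    have h2 := hB.one_add_card_mul_le hY Finset.inter_subset_left hz hzS
      (fun t ht t' ht' h => by
        by_contra hne
        have hzt : z ≠ t := fun h => hzS (h ▸ ht)
        have h2 := hB.eq_of_mem z t hzt t' h t (hB.right_mem z t hzt) hne
        have h3 := hS t' ht' t ht hne
        rw [h2] at h3
        exact hzS (h3 (hB.left_mem z t hzt)))
    rw [hc] at h2
    obtain ⟨m, rfl⟩ : ∃ m, q = m + 3 := ⟨q - 3, by omega⟩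
    rw [show m + 3 - 1 = m + 2 by omega] at h1 h2
    nlinarith [Nat.mul_le_mul_right (m + 2) h1]
  exact Finset.eq_of_subset_of_card_le (hsub.trans Finset.inter_subset_right) (by rw [hc, hc'])

/-- The ordered triangles in `Y`. -/
def triangles (B : P → P → Finset P) (Y : Finset P) : Finset (Σ _ : P × P, P) :=
  Y.offDiag.sigma fun p => Y \ B p.1 p.2

theorem IsLineFunction.card_triangles (hB : IsLineFunction B q) {Y : Finset P}
    (hY : IsLineClosed B Y) :
    (triangles B Y).card = (Y.card * Y.card - Y.card) * (Y.card - q) := by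
  rw [triangles, Finset.card_sigma, ← Finset.offDiag_card, ← smul_eq_mul, ← Finset.sum_const]
  refine Finset.sum_congr rfl fun p hp => ?_
  rw [Finset.mem_offDiag] at hp
  rw [Finset.card_sdiff_of_subset (hY _ hp.1 _ hp.2.1 hp.2.2), hB.card_eq _ _ hp.2.2]

/-- In a linear space with `q ^ 3` points and line size `q`, there are at most `q (q² + q + 1)`
subspaces with `q ^ 2` points. -/
theorem IsLineFunction.card_le [Fintype P] (hB : IsLineFunction B q) (hq : 2 < q)
    (hP : Fintype.card P = q ^ 3) (F : Finset (Finset P))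
    (hF : ∀ Y ∈ F, IsLineClosed B Y ∧ Y.card = q ^ 2) : F.card ≤ q * (q ^ 2 + q + 1) := by
  have hdisj : ∀ Y ∈ F, ∀ Y' ∈ F, Y ≠ Y' → Disjoint (triangles B Y) (triangles B Y') := by
    intro Y hY Y' hY' hne
    rw [Finset.disjoint_left]
    rintro ⟨⟨a, b⟩, c⟩ h h'
    simp only [triangles, Finset.mem_sigma, Finset.mem_offDiag, Finset.mem_sdiff] at h h'
    refine hne (hB.eq_of_mem_triangle hq (hF Y hY).1 (hF Y' hY').1 (hF Y hY).2 (hF Y' hY').2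
      (a := a) (b := b) (c := c) ?_ ?_ ?_ h.1.2.2 h.2.2) <;> rw [Finset.mem_inter] <;> tauto
  have hcard := Finset.card_biUnion hdisj
  rw [Finset.sum_congr rfl (fun Y hY => by
    rw [hB.card_triangles (hF Y hY).1, (hF Y hY).2]), Finset.sum_const, smul_eq_mul] at hcard
  have hsub : F.biUnion (triangles B) ⊆ triangles B Finset.univ := by
    intro x hx
    obtain ⟨Y, -, hx⟩ := Finset.mem_biUnion.mp hx
    simp only [triangles, Finset.mem_sigma, Finset.mem_offDiag, Finset.mem_sdiff,
      Finset.mem_univ, true_and] at hx ⊢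
    exact ⟨hx.1.2.2, hx.2.2⟩
  have h1 := Finset.card_le_card hsub
  rw [hcard, hB.card_triangles (fun _ _ _ _ _ => Finset.subset_univ _), Finset.card_univ, hP] at h1
  have e1 : q ^ 2 ≤ q ^ 2 * q ^ 2 := Nat.le_mul_self _
  have e2 : q ^ 3 ≤ q ^ 3 * q ^ 3 := Nat.le_mul_self _
  have e3 : q ≤ q ^ 2 := Nat.le_self_pow (by norm_num) q
  have e4 : q ≤ q ^ 3 := Nat.le_self_pow (by norm_num) q
  have e5 : q < q ^ 2 := by nlinarith
  have e6 : q ^ 2 < q ^ 2 * q ^ 2 := by nlinarith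
  zify [e1, e2, e3, e4] at h1 ⊢
  zify at e5 e6
  -- The bound is the quotient of the triangle counts `(q⁶ - q³)(q³ - q)` of the space and `(q⁴ -
  -- q²)(q² - q)` of a subspace.
  have hpos : 0 < ((q : ℤ) ^ 2 * q ^ 2 - q ^ 2) * (q ^ 2 - q) :=
    mul_pos (sub_pos.mpr e6) (sub_pos.mpr e5)
  refine le_of_mul_le_mul_right (h1.trans (le_of_eq ?_)) hpos
  ring

end LinearSpace

/-! ### The twisted geometries are designs -/

section Design

/-- The lines of a `2`-`(v, q, 1)`-design form a linear space. -/
theorem exists_isLineFunction {P : Type*} [Fintype P] {B : Set (Set P)} {v q : ℕ}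
    (hB : IsTwoDesign B v q 1) :
    ∃ b : P → P → Finset P, IsLineFunction b q ∧
      ∀ x y, x ≠ y → (b x y : Set P) ∈ B := by
  classical
  obtain ⟨-, hk, h1⟩ := hB
  have h2 : ∀ x y : P, ∃ s : Finset P, x ≠ y →
      ((s : Set P) ∈ B ∧ x ∈ s ∧ y ∈ s ∧ ∀ S ∈ B, x ∈ S → y ∈ S → S = s) := by
    intro x y
    by_cases hxy : x = y
    -- A default value: the joining line matters only for distinct points.
    · exact ⟨∅, fun h => absurd hxy h⟩
    obtain ⟨S, hS⟩ := Set.ncard_eq_one.mp (h1 x y hxy)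
    have hS' : S ∈ B ∧ x ∈ S ∧ y ∈ S := by
      have : S ∈ {S | S ∈ B ∧ x ∈ S ∧ y ∈ S} := hS ▸ Set.mem_singleton S
      exact this
    refine ⟨S.toFinset, fun _ => ?_⟩
    simp only [Set.coe_toFinset, Set.mem_toFinset]
    refine ⟨hS'.1, hS'.2.1, hS'.2.2, fun S' h h' h'' => ?_⟩
    have : S' ∈ {S | S ∈ B ∧ x ∈ S ∧ y ∈ S} := ⟨h, h', h''⟩
    rw [hS] at this
    exact this
  choose b hb using h2
  refine ⟨b, ⟨fun x y h => (hb x y h).2.1, fun x y h => (hb x y h).2.2.1, fun x y h => ?_,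
    fun x y h z hz w hw hzw => ?_⟩, fun x y h => (hb x y h).1⟩
  · rw [← Set.ncard_coe_finset, hk _ (hb x y h).1]
  · exact_mod_cast ((hb z w hzw).2.2.2 _ (hb x y h).1 hz hw).symm

theorem ncard_imageUnder {V : Type*} {Y : Set V} (π : Equiv.Perm Y) {L : Set V} (hL : L ⊆ Y) :
    (imageUnder π L).ncard = L.ncard := by
  have h1 : imageUnder π L = (Subtype.val ∘ π) '' (Subtype.val ⁻¹' L) := by
    ext y
    simp [imageUnder]
  rw [h1, Set.ncard_image_of_injective _ (Subtype.val_injective.comp π.injective),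
    ← Set.ncard_image_of_injective _ Subtype.val_injective, Subtype.image_preimage_coe,
    Set.inter_eq_right.mpr hL]

variable {K V : Type*} [Field K] [AddCommGroup V] [Module K V] {X : AffineSubspace K V}

theorem subset_of_mem_twistedBlocks {π : Equiv.Perm X} {S : Set V} (hS : S ∈ twistedBlocks X π)
    {x y : V} (hx : x ∈ S) (hy : y ∈ S) (hxX : x ∈ X) (hyX : y ∈ X) (hxy : x ≠ y) : S ⊆ X := by
  rcases hS with ⟨hS, -⟩ | ⟨L, -, -, rfl⟩
  · rw [eq_line_of_mem_affineLines hS hx hy hxy]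
    exact line_subset hxX (sub_mem_direction hyX hxX)
  · exact imageUnder_subset (Y := (X : Set V)) _ _

/-- Two points of `X` are joined only by blocks inside `X`, namely by the `π`-image of the line
through their `π`-preimages. Any other pair is joined by its ordinary line, which is not in `X`. -/
theorem isTwoDesign_twistedBlocks [Finite K] (hV : Module.finrank K V = 3) (π : Equiv.Perm X) :
    IsTwoDesign (twistedBlocks X π) (Nat.card K ^ 3) (Nat.card K) 1 := by
  have := Module.finite_of_finrank_pos (R := K) (M := V) (by omega)
  refine ⟨by rw [Module.natCard_eq_pow_finrank (K := K), hV], ?_, fun x y hxy => ?_⟩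
  · rintro S (⟨hS, -⟩ | ⟨L, hL, hLX, rfl⟩)
    · exact ncard_of_mem_affineLines hS
    · rw [ncard_imageUnder (Y := (X : Set V)) π hLX, ncard_of_mem_affineLines hL]
  rw [Set.ncard_eq_one]
  by_cases hX : x ∈ X ∧ y ∈ X
  · set x' : X := π⁻¹ ⟨x, hX.1⟩ with hx'
    set y' : X := π⁻¹ ⟨y, hX.2⟩ with hy'
    have hx : (π x' : V) = x := by simp [hx']
    have hy : (π y' : V) = y := by simp [hy']
    have hne : (x' : V) ≠ y' := by
      intro h
      rw [← hx, ← hy, Subtype.ext h] at hxy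
      exact hxy rfl
    have hl : line K (x' : V) (y' - x') ⊆ X := line_subset x'.2 (sub_mem_direction y'.2 x'.2)
    refine ⟨imageUnder (X := (X : Set V)) π (line K (x' : V) (y' - x')), ?_⟩
    ext S
    constructor
    · rintro ⟨hS, hxS, hyS⟩
      have hSX := subset_of_mem_twistedBlocks hS hxS hyS hX.1 hX.2 hxy
      rcases hS with ⟨-, h⟩ | ⟨L, hL, hLX, rfl⟩
      · exact absurd hSX h
      · obtain ⟨a, ha, hax⟩ := hxS
        obtain ⟨b, hb, hby⟩ := hyS
        obtain rfl : a = x' := π.injective (Subtype.ext (hax.trans hx.symm))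
        obtain rfl : b = y' := π.injective (Subtype.ext (hby.trans hy.symm))
        rw [Set.mem_singleton_iff, ← eq_line_of_mem_affineLines hL ha hb hne]
    · rintro rfl
      exact ⟨Or.inr ⟨_, line_mem_affineLines _ (sub_ne_zero.mpr hne.symm), hl, rfl⟩,
        ⟨x', left_mem_line _ _, hx⟩, ⟨y', right_mem_line _ _, hy⟩⟩
  · refine ⟨line K x (y - x), ?_⟩
    ext S
    constructor
    · rintro ⟨hS | ⟨L, hL, hLX, rfl⟩, hxS, hyS⟩
      · exact eq_line_of_mem_affineLines hS.1 hxS hyS hxy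
      · exact absurd ⟨imageUnder_subset (Y := (X : Set V)) _ _ hxS,
          imageUnder_subset (Y := (X : Set V)) _ _ hyS⟩ hX
    · rintro rfl
      exact ⟨Or.inl ⟨line_mem_affineLines _ (sub_ne_zero.mpr hxy.symm), fun h =>
        hX ⟨h (left_mem_line _ _), h (right_mem_line _ _)⟩⟩, left_mem_line _ _, right_mem_line _ _⟩

end Design

/-! ### Size of an isomorphism class -/

section Counting

theorem IsIso.trans {P P' P'' : Type*} {B : Set (Set P)} {B' : Set (Set P')} {B'' : Set (Set P'')}
    {g : P ≃ P'} {g' : P' ≃ P''} (hg : IsIso B B' g) (hg' : IsIso B' B'' g') :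
    IsIso B B'' (g.trans g') := fun S => by
  rw [hg S, hg' (g '' S), Set.image_image]
  rfl

theorem IsIso.symm {P P' : Type*} {B : Set (Set P)} {B' : Set (Set P')} {g : P ≃ P'}
    (hg : IsIso B B' g) : IsIso B' B g.symm := fun S => by
  rw [hg (g.symm '' S), Set.image_image]
  simp

theorem isIso_refl {P : Type*} (B : Set (Set P)) : IsIso B B (Equiv.refl P) := fun S => by simp

theorem card_doubleCoset_le {G : Type*} [Group G] [Finite G] (H : Subgroup G) (a : G) :
    (DoubleCoset.doubleCoset a (H : Set G) H).ncard ≤ Nat.card H ^ 2 := by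
  have h1 : DoubleCoset.doubleCoset a (H : Set G) H =
      Set.range fun p : H × H => (p.1 : G) * a * p.2 := by
    ext x
    rw [DoubleCoset.mem_doubleCoset]
    constructor
    · rintro ⟨h, hh, k, hk, rfl⟩
      exact ⟨(⟨h, hh⟩, ⟨k, hk⟩), rfl⟩
    · rintro ⟨⟨h, k⟩, rfl⟩
      exact ⟨h, h.2, k, k.2, rfl⟩
  rw [h1, sq, ← Nat.card_prod, ← Nat.card_coe_set_eq]
  exact Finite.card_range_le _

variable {K V : Type*} [Field K] [AddCommGroup V] [Module K V] {X : AffineSubspace K V}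

theorem card_affineSemilinearGroup_le [Finite K] [Nonempty X]
    (hX : Module.finrank K X.direction = 2) :
    Nat.card (affineSemilinearGroup K X.direction X) ≤
      Nat.card (affineSemilinearGroup K (Fin 2 → K) (Fin 2 → K)) := by
  have := Module.finite_of_finrank_pos (R := K) (M := X.direction) (by omega)
  obtain ⟨o⟩ := ‹Nonempty X›
  let e : X.direction ≃ₗ[K] (Fin 2 → K) := LinearEquiv.ofFinrankEq _ _ (by simp [hX])
  let E : X ≃ (Fin 2 → K) := (Equiv.vaddConst o).symm.trans e.toEquiv
  have hE : ∀ x y, E x - E y = e (x -ᵥ y) := fun x y => by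
    change e (x -ᵥ o) - e (y -ᵥ o) = _
    rw [← map_sub, vsub_sub_vsub_cancel_right]
  refine Nat.card_le_card_of_injective
    (fun h => ⟨E.permCongr h.1, ?_⟩) fun h h' hh => Subtype.ext ?_
  · obtain ⟨σ, A, hA, he⟩ := h.2
    refine ⟨σ, (e.symm.toAddEquiv.trans A).trans e.toAddEquiv, fun a v => ?_, fun x y => ?_⟩
    · simp only [AddEquiv.trans_apply]
      change e (A (e.symm (a • v))) = σ a • e (A (e.symm v))
      rw [map_smul, hA, map_smul]
    · obtain ⟨x, rfl⟩ := E.surjective x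
      obtain ⟨y, rfl⟩ := E.surjective y
      change E (h.1 (E.symm (E x))) - E (h.1 (E.symm (E y))) = e (A (e.symm (E x - E y)))
      rw [Equiv.symm_apply_apply, Equiv.symm_apply_apply, hE, hE, he, LinearEquiv.symm_apply_apply]
  · exact E.permCongr.injective (congrArg Subtype.val hh)

/-- The preimage of `X` under an isomorphism `D_π → D_π'` is a subspace of `D_π`. -/
theorem isLineClosed_of_isIso [DecidableEq V] {π π' : Equiv.Perm X} {g : Equiv.Perm V}
    (hg : IsIso (twistedBlocks X π) (twistedBlocks X π') g) {b : V → V → Finset V} {q : ℕ}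
    (hb : IsLineFunction b q) (hbB : ∀ x y, x ≠ y → (b x y : Set V) ∈ twistedBlocks X π)
    {Y : Finset V} (hY : g '' (Y : Set V) = X) : IsLineClosed b Y := by
  have hmem : ∀ z, g z ∈ X ↔ z ∈ Y := fun z => by
    rw [← SetLike.mem_coe, ← hY, g.injective.mem_set_image, Finset.mem_coe]
  intro x hx y hy hxy z hz
  have h1 := subset_of_mem_twistedBlocks ((hg _).mp (hbB x y hxy))
    (Set.mem_image_of_mem g (hb.left_mem x y hxy)) (Set.mem_image_of_mem g (hb.right_mem x y hxy))
    ((hmem x).mpr hx) ((hmem y).mpr hy) (g.injective.ne hxy)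
  exact (hmem z).mp (h1 (Set.mem_image_of_mem g hz))

theorem natCard_eq [Nonempty X] [Finite K] (hX : Module.finrank K X.direction = 2) :
    Nat.card X = Nat.card K ^ 2 := by
  have := Module.finite_of_finrank_pos (R := K) (M := X.direction) (by omega)
  obtain ⟨o⟩ := ‹Nonempty X›
  rw [← Nat.card_congr (Equiv.vaddConst o), Module.natCard_eq_pow_finrank (K := K), hX]

/-- Send `π'` to the preimage `Φ π'` of `X` under a chosen isomorphism. The values are subspaces,
counted by `IsLineFunction.card_le`. If `Φ π₀ = Φ π'`, going back by `g π₀` and on by `g π'`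
preserves `X`, so a fibre lies in one double coset. -/
theorem ncard_isomorphic_le [Nonempty X] (hK : 2 < Nat.card K) (hV : Module.finrank K V = 3)
    (hX : Module.finrank K X.direction = 2) (π : Equiv.Perm X) :
    {π' : Equiv.Perm X | Isomorphic (twistedBlocks X π) (twistedBlocks X π')}.ncard ≤
      Nat.card (affineSemilinearGroup K X.direction X) ^ 2 *
        (Nat.card K * (Nat.card K ^ 2 + Nat.card K + 1)) := by
  classical
  have : Finite K := Nat.finite_of_card_ne_zero (by omega)
  have := Module.finite_of_finrank_pos (R := K) (M := V) (by omega)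
  have : Finite V := Module.finite_of_finite K
  have := Fintype.ofFinite V
  have := Fintype.ofFinite X
  have hD := isTwoDesign_twistedBlocks hV π
  obtain ⟨b, hb, hbB⟩ := exists_isLineFunction hD
  have hex : ∀ π' : Equiv.Perm X, ∃ g : Equiv.Perm V,
      Isomorphic (twistedBlocks X π) (twistedBlocks X π') →
        IsIso (twistedBlocks X π) (twistedBlocks X π') g := fun π' => by
    by_cases h : Isomorphic (twistedBlocks X π) (twistedBlocks X π')
    · exact ⟨h.choose, fun _ => h.choose_spec⟩
    · exact ⟨1, fun h' => absurd h' h⟩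
  choose g hg using hex
  let Φ : Equiv.Perm X → Finset V := fun π' => (g π' ⁻¹' (X : Set V)).toFinset
  have hΦ : ∀ π', g π' '' (Φ π' : Set V) = X := fun π' => by
    rw [Set.coe_toFinset, Set.image_preimage_eq _ (g π').surjective]
  set C : Finset (Equiv.Perm X) :=
    {π' | Isomorphic (twistedBlocks X π) (twistedBlocks X π')} with hC
  have hCmem : ∀ π', π' ∈ C ↔ Isomorphic (twistedBlocks X π) (twistedBlocks X π') := fun π' => by
    simp [hC]
  have h1 : (C.image Φ).card ≤ Nat.card K * (Nat.card K ^ 2 + Nat.card K + 1) := by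
    refine hb.card_le hK (by rw [← Nat.card_eq_fintype_card]; exact hD.1) _ fun Y hY => ?_
    obtain ⟨π', hπ', rfl⟩ := Finset.mem_image.mp hY
    refine ⟨isLineClosed_of_isIso (hg π' ((hCmem π').mp hπ')) hb hbB (hΦ π'), ?_⟩
    rw [← Set.ncard_coe_finset, ← Set.ncard_image_of_injective _ (g π').injective, hΦ,
      ← Nat.card_coe_set_eq]
    exact natCard_eq hX
  have h2 : C.card ≤ Nat.card (affineSemilinearGroup K X.direction X) ^ 2 * (C.image Φ).card := by
    refine Finset.card_le_mul_card_image C _ fun Y hY => ?_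
    obtain ⟨π₀, hπ₀, rfl⟩ := Finset.mem_image.mp hY
    refine le_trans ?_ (card_doubleCoset_le _ π₀)
    rw [← Set.ncard_coe_finset]
    refine Set.ncard_le_ncard fun π' hπ' => ?_
    simp only [Finset.coe_filter, Set.mem_ofPred_eq] at hπ'
    rw [← exists_isIso_image_eq_iff hK hV hX]
    refine ⟨(g π₀).symm.trans (g π'),
      (hg π₀ ((hCmem _).mp hπ₀)).symm.trans (hg π' ((hCmem _).mp hπ'.1)), ?_⟩
    rw [Equiv.coe_trans, Set.image_comp]
    have h3 : (g π₀).symm '' (X : Set V) = Φ π₀ := by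
      rw [← hΦ π₀, Set.image_image]
      simp
    rw [h3, ← hπ'.2, hΦ]
  have h3 : {π' : Equiv.Perm X | Isomorphic (twistedBlocks X π) (twistedBlocks X π')} =
      (C : Set (Equiv.Perm X)) := by
    ext π'
    simp [hC]
  rw [h3, Set.ncard_coe_finset]
  exact h2.trans (Nat.mul_le_mul_left _ h1)

/-- There is a large set of permutations with pairwise nonisomorphic geometries `D_π`. -/
theorem exists_pairwise_not_isomorphic [Nonempty X] (hK : 2 < Nat.card K)
    (hV : Module.finrank K V = 3) (hX : Module.finrank K X.direction = 2) :
    ∃ S : Finset (Equiv.Perm X),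
      (∀ π ∈ S, ∀ π' ∈ S, π ≠ π' → ¬ Isomorphic (twistedBlocks X π) (twistedBlocks X π')) ∧
      (Nat.card K ^ 2).factorial ≤ Nat.card (affineSemilinearGroup K X.direction X) ^ 2 *
        (Nat.card K * (Nat.card K ^ 2 + Nat.card K + 1)) * S.card := by
  classical
  have : Finite K := Nat.finite_of_card_ne_zero (by omega)
  have := Module.finite_of_finrank_pos (R := K) (M := V) (by omega)
  have : Finite V := Module.finite_of_finite K
  have := Fintype.ofFinite X
  let s : Setoid (Equiv.Perm X) :=
    { r := fun π π' => Isomorphic (twistedBlocks X π) (twistedBlocks X π')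
      iseqv := ⟨fun π => ⟨_, isIso_refl _⟩, fun ⟨g, hg⟩ => ⟨_, hg.symm⟩,
        fun ⟨g, hg⟩ ⟨g', hg'⟩ => ⟨_, hg.trans hg'⟩⟩ }
  -- One representative per isomorphism class; the fibres of `f` are the classes bounded above.
  let f : Equiv.Perm X → Equiv.Perm X := fun π => (Quotient.mk s π).out
  have hf : ∀ π, Isomorphic (twistedBlocks X (f π)) (twistedBlocks X π) := fun π =>
    Quotient.mk_out (s := s) π
  refine ⟨Finset.univ.image f, fun π hπ π' hπ' hne hiso => hne ?_, ?_⟩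
  · obtain ⟨ρ, -, rfl⟩ := Finset.mem_image.mp hπ
    obtain ⟨ρ', -, rfl⟩ := Finset.mem_image.mp hπ'
    have h1 : Quotient.mk s (f ρ) = Quotient.mk s (f ρ') := Quotient.sound (s := s) hiso
    simp only [f, Quotient.out_eq] at h1 ⊢
    rw [h1]
  · have h1 : (Nat.card K ^ 2).factorial = (Finset.univ : Finset (Equiv.Perm X)).card := by
      rw [← natCard_eq hX, ← Nat.card_perm, Nat.card_eq_fintype_card, Finset.card_univ]
    rw [h1]
    refine Finset.card_le_mul_card_image _ _ fun π _ => ?_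
    refine le_trans ?_ (ncard_isomorphic_le hK hV hX π)
    rw [← Set.ncard_coe_finset]
    refine Set.ncard_le_ncard fun π' hπ' => ?_
    simp only [Finset.coe_filter, Finset.mem_univ, true_and, Set.mem_ofPred_eq] at hπ' ⊢
    exact hπ' ▸ hf π'

end Counting

end TwistedAffine

/-! ### Assembly of the four statements -/

theorem proposition5p1 (q : ℕ) (hq : 2 < q)
    (K : Type*) [Field K] (hK : Nat.card K = q)
    (V : Type*) [AddCommGroup V] [Module K V] (hV : Module.finrank K V = 3)
    (X : AffineSubspace K V) [Nonempty X] (hX : Module.finrank K X.direction = 2) :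
    -- isomorphisms sending `X` to itself and double cosets
    (∀ π π' : Equiv.Perm X,
      (∃ g : Equiv.Perm V,
        TwistedAffine.IsIso (TwistedAffine.twistedBlocks X π) (TwistedAffine.twistedBlocks X π') g ∧
          g '' (X : Set V) = X) ↔
      DoubleCoset.doubleCoset π
          (TwistedAffine.affineSemilinearGroup K X.direction X : Set (Equiv.Perm X))
          (TwistedAffine.affineSemilinearGroup K X.direction X : Set (Equiv.Perm X)) =
        DoubleCoset.doubleCoset π'
          (TwistedAffine.affineSemilinearGroup K X.direction X : Set (Equiv.Perm X))
          (TwistedAffine.affineSemilinearGroup K X.direction X : Set (Equiv.Perm X))) ∧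
    -- many pairwise nonisomorphic designs with the parameters of the point-line design
    (∃ S : Finset (Equiv.Perm X),
      (∀ π ∈ S, TwistedAffine.IsTwoDesign (TwistedAffine.twistedBlocks X π) (q ^ 3) q 1) ∧
      (∀ π ∈ S, ∀ π' ∈ S, π ≠ π' →
        ¬ TwistedAffine.Isomorphic
          (TwistedAffine.twistedBlocks X π) (TwistedAffine.twistedBlocks X π')) ∧
      (Nat.factorial (q ^ 2) : ℝ) /
          ((q : ℝ) * ((q : ℝ) ^ 2 + q + 1) *
            (Nat.card (TwistedAffine.affineSemilinearGroup K (Fin 2 → K) (Fin 2 → K)) : ℝ) ^ 2) ≤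
        S.card) ∧
    -- the pointwise stabilizer of `X` is transitive on the points outside `X`
    (∀ π : Equiv.Perm X, ∀ x y : V, x ∉ X → y ∉ X →
      ∃ g ∈ TwistedAffine.autGroup (TwistedAffine.twistedBlocks X π),
        (∀ z ∈ X, g z = z) ∧ g x = y) ∧
    -- the group induced on `X` by its setwise stabilizer; for permutations acting on the right,
    -- the conjugate `h ^ π` is the map `π ∘ h ∘ π⁻¹`
    (∀ π : Equiv.Perm X,
      TwistedAffine.inducedGroup (TwistedAffine.autGroup (TwistedAffine.twistedBlocks X π))
          (X : Set V) =
        TwistedAffine.affineSemilinearGroup K X.direction X ⊓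
          (TwistedAffine.affineSemilinearGroup K X.direction X).map
            (MulAut.conj π).toMonoidHom) := by
  have hK2 : 2 < Nat.card K := hK ▸ hq
  have : Finite K := Nat.finite_of_card_ne_zero (by omega)
  refine ⟨fun π π' => ?_, ?_, fun π x y hx hy => ?_, fun π => ?_⟩
  · rw [TwistedAffine.exists_isIso_image_eq_iff hK2 hV hX]
    constructor
    · exact fun h => (DoubleCoset.doubleCoset_eq_of_mem h).symm
    · exact fun h => h ▸ DoubleCoset.mem_doubleCoset_self _ _ π'
  · obtain ⟨S, hS, hcard⟩ := TwistedAffine.exists_pairwise_not_isomorphic (X := X) hK2 hV hX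
    refine ⟨S, fun π _ => hK ▸ TwistedAffine.isTwoDesign_twistedBlocks hV π, hS, ?_⟩
    set N := Nat.card (TwistedAffine.affineSemilinearGroup K (Fin 2 → K) (Fin 2 → K))
    have hN : 0 < N := Nat.card_pos
    have h1 := Nat.pow_le_pow_left (TwistedAffine.card_affineSemilinearGroup_le (X := X) hX) 2
    rw [hK] at hcard
    have h2 := hcard.trans (Nat.mul_le_mul_right _ (Nat.mul_le_mul_right _ h1))
    have h3 : ((q ^ 2).factorial : ℝ) ≤ N ^ 2 * (q * (q ^ 2 + q + 1)) * S.card := by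
      exact_mod_cast h2
    rw [div_le_iff₀ (by positivity)]
    linarith
  -- Extend the identity of `X` so that `x` goes to `y`; then `π⁻¹ * 1 * π = 1` meets the remaining
  -- condition for every `π`.
  · obtain ⟨g, hg, hgh, hxy⟩ := TwistedAffine.exists_extension hV hX
      (one_mem (TwistedAffine.affineSemilinearGroup K X.direction X)) hx hy
    refine ⟨g, TwistedAffine.isIso_of_mem hg hgh ?_, fun z hz => hgh ⟨z, hz⟩, hxy⟩
    rw [mul_one, inv_mul_cancel]
    exact one_mem _
  · ext h
    have h1 : h ∈ (TwistedAffine.affineSemilinearGroup K X.direction X).map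
        (MulAut.conj π).toMonoidHom ↔
          π⁻¹ * h * π ∈ TwistedAffine.affineSemilinearGroup K X.direction X := by
      rw [Subgroup.mem_map]
      constructor
      · rintro ⟨k, hk, rfl⟩
        convert hk using 1
        simp [mul_assoc]
      · exact fun hk => ⟨_, hk, by simp [mul_assoc]⟩
    rw [Subgroup.mem_inf, h1, ← TwistedAffine.exists_isIso_iff hK2 hV hX]
    constructor
    · rintro ⟨g, hg, -, hgh⟩
      exact ⟨g, hg, hgh⟩
    · rintro ⟨g, hg, hgh⟩
      exact ⟨g, hg, TwistedAffine.image_eq_of_forall (Y := (X : Set V)) hgh, hgh⟩
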